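/- Let $L:\mathbb{T}^n\times\mathbb{R}^n\to\mathbb{R}$ be a smooth Lagrangian on the flat torus $\mathbb{T}^n=\mathbb{R}^n/\mathbb{Z}^n$ which is uniformly convex in the velocity, $D^2_{vv}L(x,v)\ge\gamma>0$ for some constant $\gamma$, superlinear, $\lim_{|v|\to\infty}L(x,v)/|v|=\infty$, and satisfies $|D_xL(x,v)|\le C$ for some constant $C$. Fix $T>0$. For a Borel probability measure $\theta$ on $\mathbb{T}^n$ let $\Pi(T,\theta)$ be the set of finite nonnegative Borel measures $\rho$ on $[0,T]\times\mathbb{T}^n\times\mathbb{R}^n$ with $\int|v|\,d\rho<\infty$ such that $$\int\big(\varphi_t(x,t)+v\cdot D_x\varphi(x,t)\big)\,d\rho(t,x,v)=\int_{\mathbb{T}^n}\big(\varphi(x,T)-\varphi(x,0)\big)\,d\theta(x)$$ for all smooth $\varphi:\mathbb{T}^n\times[0,T]\to\mathbb{R}$. For $Q\in\mathbb{R}^n$ let $\Pi(T,\theta,Q)$ be the set of those $\rho\in\Pi(T,\theta)$ with $\int v\,d\rho=Q$. Put $$g^T(\theta)=\inf_{\rho\in\Pi(T,\theta)}\int L(x,v)\,d\rho,\qquad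 g_Q^T(\theta)=\inf_{\rho\in\Pi(T,\theta,Q)}\int L(x,v)\,d\rho .$$ Then for every $Q\in\mathbb{R}^n$ there is a minimax measure for $g_Q^T$ supported at a single point: there is $x^*\in\mathbb{T}^n$ such that $g_Q^T(\theta)\le g_Q^T(\delta_{x^*})$ for every Borel probability measure $\theta$ on $\mathbb{T}^n$, and the value $g_Q^T(\delta_{x^*})$ is finite and attained by some $\rho\in\Pi(T,\delta_{x^*},Q)$. The same holds without the rotation constraint: there is $x^*\in\mathbb{T}^n$ such that $g^T(\theta)\le g^T(\delta_{x^*})$ for every Borel probability measure $\theta$ on $\mathbb{T}^n$, and $g^T(\delta_{x^*})$ is finite and attained by some $\rho\in\Pi(T,\delta_{x^*})$. -/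

import Mathlib

open MeasureTheory
open scoped ContDiff

noncomputable section

namespace MinimaxMather

/-- The space `ℝⁿ` of velocities, with its Euclidean norm. -/
abbrev Vel (n : ℕ) : Type := EuclideanSpace ℝ (Fin n)

/-- The flat torus `𝕋ⁿ = ℝⁿ / ℤⁿ`. -/
abbrev Torus (n : ℕ) : Type := UnitAddTorus (Fin n)

/-- The covering map `ℝⁿ → 𝕋ⁿ`. -/
def proj {n : ℕ} (h : Vel n) : Torus n := fun i => ((h i : ℝ) : UnitAddCircle)

/-- The differential `D_x f(x)` of a function on the torus: the differential at `0` of the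
function `h ↦ f (x + h)` on `ℝⁿ`. -/
def torusFDeriv {n : ℕ} (f : Torus n → ℝ) (x : Torus n) : Vel n →L[ℝ] ℝ :=
  fderiv ℝ (fun h : Vel n => f (x + proj h)) 0

/-- The assumptions on the Lagrangian `L : 𝕋ⁿ × ℝⁿ → ℝ`. -/
structure IsLagrangian {n : ℕ} (L : Torus n → Vel n → ℝ) : Prop where
  /-- `L` is smooth (that is, its `ℤⁿ`-periodic lift to `ℝⁿ × ℝⁿ` is). -/
  smooth : ContDiff ℝ ∞ (fun p : Vel n × Vel n => L (proj p.1) p.2)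
  /-- `D²_vv L ≥ γ > 0`. -/
  convex : ∃ γ : ℝ, 0 < γ ∧ ∀ (x : Torus n) (v w : Vel n),
    γ * ‖w‖ ^ 2 ≤ fderiv ℝ (fderiv ℝ (L x)) v w w
  /-- `L(x,v) / |v| → ∞` as `|v| → ∞`. -/
  superlinear : ∀ x : Torus n,
    Filter.Tendsto (fun v : Vel n => L x v / ‖v‖) (Bornology.cobounded (Vel n)) Filter.atTop
  /-- `|D_x L| ≤ C`. -/
  bounded_deriv : ∃ C : ℝ, ∀ (x : Torus n) (v : Vel n), ‖torusFDeriv (fun y => L y v) x‖ ≤ C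

/-- Smooth functions `φ(t,x)` on `ℝ × 𝕋ⁿ`. Their restrictions to `[0,T] × 𝕋ⁿ` are exactly the
smooth functions on `[0,T] × 𝕋ⁿ`. -/
def IsSmoothTest {n : ℕ} (φ : ℝ → Torus n → ℝ) : Prop :=
  ContDiff ℝ ∞ (fun p : ℝ × Vel n => φ p.1 (proj p.2))

/-- `Π(T, θ)`: the (finite, nonnegative) measures `ρ(t,x,v)` on `[0,T] × 𝕋ⁿ × ℝⁿ`, with
integrable velocity, which satisfy the periodic holonomy constraint
`∫ (φ_t + v · D_x φ) dρ = ∫ (φ(T,x) - φ(0,x)) dθ` for all smooth `φ`. -/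
structure IsPlan {n : ℕ} (T : ℝ) (θ : Measure (Torus n)) (ρ : Measure (ℝ × Torus n × Vel n)) :
    Prop where
  finite : IsFiniteMeasure ρ
  time_mem : ∀ᵐ p ∂ρ, p.1 ∈ Set.Icc 0 T
  integrable_vel : Integrable (fun p : ℝ × Torus n × Vel n => p.2.2) ρ
  holonomy : ∀ φ : ℝ → Torus n → ℝ, IsSmoothTest φ →
    ∫ p, (deriv (fun s => φ s p.2.1) p.1 + torusFDeriv (φ p.1) p.2.1 p.2.2) ∂ρ
      = ∫ x, (φ T x - φ 0 x) ∂θ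

/-- The set `Π(T, θ)`. -/
def plans {n : ℕ} (T : ℝ) (θ : Measure (Torus n)) : Set (Measure (ℝ × Torus n × Vel n)) :=
  {ρ | IsPlan T θ ρ}

/-- The set `Π(T, θ, Q)`: the plans which also satisfy the rotation constraint `∫ v dρ = Q`. -/
def plansRot {n : ℕ} (T : ℝ) (Q : Vel n) (θ : Measure (Torus n)) :
    Set (Measure (ℝ × Torus n × Vel n)) :=
  {ρ | IsPlan T θ ρ ∧ ∫ p, p.2.2 ∂ρ = Q}

open Classical in
/-- The action `∫ L dρ ∈ (-∞, +∞]`. For a continuous `L` that is bounded below and a finite measure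
`ρ` the integral is `+∞` exactly if `L` is not integrable. -/
def action {n : ℕ} (L : Torus n → Vel n → ℝ) (ρ : Measure (ℝ × Torus n × Vel n)) : EReal :=
  if Integrable (fun p : ℝ × Torus n × Vel n => L p.2.1 p.2.2) ρ then
    ((∫ p, L p.2.1 p.2.2 ∂ρ : ℝ) : EReal)
  else ⊤

/-- The infimum of the action over a set of plans. -/
def minAction {n : ℕ} (L : Torus n → Vel n → ℝ) (S : Set (Measure (ℝ × Torus n × Vel n))) :
    EReal :=
  ⨅ ρ ∈ S, action L ρ

/-- `g^T(θ)`: the minimal action without rotation constraint. -/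
def g {n : ℕ} (L : Torus n → Vel n → ℝ) (T : ℝ) (θ : Measure (Torus n)) : EReal :=
  minAction L (plans T θ)

/-- `g_Q^T(θ)`: the minimal action with rotation constraint. -/
def gRot {n : ℕ} (L : Torus n → Vel n → ℝ) (T : ℝ) (Q : Vel n) (θ : Measure (Torus n)) : EReal :=
  minAction L (plansRot T Q θ)

/-- `θ` is a minimax measure for `G`: a probability measure at which `G` attains its supremum over
all Borel probability measures on the torus. -/
def IsMinimax {n : ℕ} (G : Measure (Torus n) → EReal) (θ : Measure (Torus n)) : Prop :=
  IsProbabilityMeasure θ ∧ ∀ θ' : Measure (Torus n), IsProbabilityMeasure θ' → G θ' ≤ G θ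

/-- `ρ` realizes the minimal action over `S`, which is finite. -/
def IsMinimizer {n : ℕ} (L : Torus n → Vel n → ℝ) (S : Set (Measure (ℝ × Torus n × Vel n)))
    (ρ : Measure (ℝ × Torus n × Vel n)) : Prop :=
  ρ ∈ S ∧ action L ρ = minAction L S ∧ action L ρ ≠ ⊤

end MinimaxMather

end

noncomputable section

namespace MinimaxMather

open Filter Topology

/-! ### The covering map and derivatives on the torus -/

section Torus

variable {n : ℕ}

/-! The pairs (θ, ρ) with ρ a plan over θ form a convex cone, invariant under translating positions
in 𝕋ⁿ. Translation leaves velocities, hence the rotation vector, unchanged, and the bound on D_x L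
makes the action of a plan over a point mass change by at most a constant times T‖h‖. So G(x) =
g(δ_x) is Lipschitz and has a maximum at some x* on the compact torus. A general θ is a
superposition of point masses: cut it into finitely many small pieces near centres c, and spread an
optimal plan over δ_c along each piece by translations. The sum is a plan over θ with action at most
G(x*) + ε (`exists_plan_of_dirac_le`), whence g(θ) ≤ G(x*). With finitely many centres no measurable
choice of minimizers is needed.

Over a point mass the infimum is finite because closed straight loops superpose to a plan with any
rotation vector (`exists_plan_dirac`). It is attained by the direct method
(`exists_minimizer_dirac`, `exists_integral_minimizer`): superlinearity gives tightness, and it lets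
the constraints, which grow at most linearly in v, pass to the weak limit.

Both claims are treated at once by testing the rotation vector only against directions in a set W,
taken to be everything or empty. The mass of θ enters this constraint to keep it additive in (θ, ρ).
-/

theorem proj_add (h k : Vel n) : proj (h + k) = proj h + proj k := by
  ext i; simp [proj]

theorem isOpenQuotientMap_proj : IsOpenQuotientMap (proj : Vel n → Torus n) := by
  have h1 : IsOpenQuotientMap (Pi.map (fun (_ : Fin n) (r : ℝ) => (r : UnitAddCircle))) :=
    IsOpenQuotientMap.piMap fun _ => QuotientAddGroup.isOpenQuotientMap_mk
  exact h1.comp (EuclideanSpace.equiv (Fin n) ℝ).toHomeomorph.isOpenQuotientMap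

theorem continuous_proj : Continuous (proj : Vel n → Torus n) :=
  isOpenQuotientMap_proj.continuous

/-- Reduce each coordinate modulo its nearest integer; √n compares the sup norm of the torus with
the Euclidean norm. -/
theorem exists_proj_eq_norm_le (x : Torus n) :
    ∃ h : Vel n, proj h = x ∧ ‖h‖ ≤ √n * ‖x‖ := by
  have key : ∀ i, ∃ r : ℝ, (r : UnitAddCircle) = x i ∧ |r| = ‖x i‖ := by
    intro i
    obtain ⟨r, hr⟩ := QuotientAddGroup.mk_surjective (x i)
    refine ⟨r - round r, ?_, ?_⟩
    · rw [← hr]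
      have : ((round r : ℝ) : UnitAddCircle) = 0 := by
        rw [AddCircle.coe_eq_zero_iff]; exact ⟨round r, by simp⟩
      rw [AddCircle.coe_sub, this, sub_zero]
    · rw [← hr]
      exact (UnitAddCircle.norm_eq (x := r)).symm
  choose r hr hr' using key
  refine ⟨WithLp.toLp 2 r, funext hr, ?_⟩
  rw [EuclideanSpace.norm_eq]
  have : ∑ i, ‖(WithLp.toLp 2 r : Vel n) i‖ ^ 2 ≤ n * ‖x‖ ^ 2 := by
    calc ∑ i, ‖(WithLp.toLp 2 r : Vel n) i‖ ^ 2 ≤ ∑ _i : Fin n, ‖x‖ ^ 2 := by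
          refine Finset.sum_le_sum fun i _ => ?_
          have : ‖(WithLp.toLp 2 r : Vel n) i‖ = ‖x i‖ := hr' i
          rw [this]
          gcongr
          exact norm_le_pi_norm x i
      _ = n * ‖x‖ ^ 2 := by simp
  refine (Real.sqrt_le_sqrt this).trans ?_
  rw [Real.sqrt_mul (by positivity), Real.sqrt_sq (norm_nonneg _)]

theorem norm_torus_le (x : Torus n) : ‖x‖ ≤ 1 := by
  refine (pi_norm_le_iff_of_nonneg zero_le_one).2 fun i => ?_
  refine (AddCircle.norm_le_half_period (1 : ℝ) one_ne_zero).trans ?_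
  norm_num

theorem torusFDeriv_proj (f : Torus n → ℝ) (y : Vel n) :
    torusFDeriv f (proj y) = fderiv ℝ (fun h => f (proj h)) y := by
  unfold torusFDeriv
  have : (fun h : Vel n => f (proj y + proj h)) = fun h => (fun k => f (proj k)) (y + h) := by
    ext h; simp [proj_add]
  rw [this, fderiv_comp_add_left (f := fun k : Vel n => f (proj k)), add_zero]

theorem torusFDeriv_translate (f : Torus n → ℝ) (a x : Torus n) :
    torusFDeriv (fun y => f (y + a)) x = torusFDeriv f (x + a) := by
  unfold torusFDeriv
  simp only [add_right_comm x a]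

end Torus

/-! ### Test functions and their derivatives along (1, v) -/

section Test

variable {n : ℕ}

/-- The derivative of `φ` at the point `(t, x)` in the direction `(1, v)`. -/
def testDeriv (φ : ℝ → Torus n → ℝ) (p : ℝ × Torus n × Vel n) : ℝ :=
  deriv (fun s => φ s p.2.1) p.1 + torusFDeriv (φ p.1) p.2.1 p.2.2

theorem IsSmoothTest.differentiable {φ : ℝ → Torus n → ℝ} (hφ : IsSmoothTest φ) :
    Differentiable ℝ (fun p : ℝ × Vel n => φ p.1 (proj p.2)) :=
  ContDiff.differentiable hφ (by simp)

/-- Expressing both partial derivatives through one Fréchet derivative of the lift makes continuity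
and bounds available upstairs. -/
theorem IsSmoothTest.testDeriv_proj {φ : ℝ → Torus n → ℝ} (hφ : IsSmoothTest φ) (t : ℝ)
    (y v : Vel n) : testDeriv φ (t, proj y, v) =
      fderiv ℝ (fun p : ℝ × Vel n => φ p.1 (proj p.2)) (t, y) (1, v) := by
  have hd := (hφ.differentiable (t, y)).hasFDerivAt
  have h1 : HasDerivAt (fun s : ℝ => (s, y)) ((1 : ℝ), (0 : Vel n)) t :=
    (hasDerivAt_id t).prodMk (hasDerivAt_const t y)
  have h2 : HasFDerivAt (fun z : Vel n => (t, z)) (ContinuousLinearMap.inr ℝ ℝ (Vel n)) y :=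
    hasFDerivAt_prodMk_right t y
  have e1 := (hd.comp_hasDerivAt t h1).deriv
  have e2 := (hd.comp y h2).fderiv
  have e3 : torusFDeriv (φ t) (proj y) v =
      fderiv ℝ (fun p : ℝ × Vel n => φ p.1 (proj p.2)) (t, y) (0, v) := by
    rw [torusFDeriv_proj]
    exact (congrArg (fun l : Vel n →L[ℝ] ℝ => l v) e2)
  have e4 : deriv (fun s => φ s (proj y)) t =
      fderiv ℝ (fun p : ℝ × Vel n => φ p.1 (proj p.2)) (t, y) (1, 0) := e1
  simp only [testDeriv]
  rw [e3, e4, ← map_add]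
  simp

theorem IsSmoothTest.continuous_testDeriv {φ : ℝ → Torus n → ℝ} (hφ : IsSmoothTest φ) :
    Continuous (testDeriv φ) := by
  have hq : IsOpenQuotientMap
      (Prod.map id (Prod.map proj id) : ℝ × Vel n × Vel n → ℝ × Torus n × Vel n) :=
    IsOpenQuotientMap.id.prodMap (isOpenQuotientMap_proj.prodMap IsOpenQuotientMap.id)
  rw [← hq.continuous_comp_iff]
  have : testDeriv φ ∘ (Prod.map id (Prod.map proj id) : ℝ × Vel n × Vel n → ℝ × Torus n × Vel n)
      = fun p => fderiv ℝ (fun p : ℝ × Vel n => φ p.1 (proj p.2)) (p.1, p.2.1) (1, p.2.2) := by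
    ext ⟨t, y, v⟩
    exact hφ.testDeriv_proj t y v
  rw [this]
  have hc := ContDiff.continuous_fderiv hφ (by simp)
  exact (hc.comp (by fun_prop : Continuous fun p : ℝ × Vel n × Vel n => (p.1, p.2.1))).clm_apply
    (by fun_prop)

theorem IsSmoothTest.continuous {φ : ℝ → Torus n → ℝ} (hφ : IsSmoothTest φ) :
    Continuous (fun p : ℝ × Torus n => φ p.1 p.2) := by
  have hq : IsOpenQuotientMap (Prod.map id proj : ℝ × Vel n → ℝ × Torus n) :=
    IsOpenQuotientMap.id.prodMap isOpenQuotientMap_proj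
  rw [← hq.continuous_comp_iff]
  exact hφ.differentiable.continuous

theorem IsSmoothTest.exists_abs_testDeriv_le {φ : ℝ → Torus n → ℝ} (hφ : IsSmoothTest φ)
    (T : ℝ) : ∃ A : ℝ, 0 ≤ A ∧ ∀ t ∈ Set.Icc 0 T, ∀ x v, |testDeriv φ (t, x, v)| ≤ A * (1 + ‖v‖) := by
  have hc := ContDiff.continuous_fderiv hφ (by simp)
  obtain ⟨A, hA⟩ := (isCompact_Icc.prod (isCompact_closedBall (0 : Vel n) (√n))).exists_bound_of_continuousOn
    (s := Set.Icc 0 T ×ˢ Metric.closedBall (0 : Vel n) (√n)) hc.continuousOn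
  refine ⟨max A 0, le_max_right _ _, fun t ht x v => ?_⟩
  obtain ⟨y, rfl, hy⟩ := exists_proj_eq_norm_le x
  have hy' : ‖y‖ ≤ √n := hy.trans (mul_le_of_le_one_right (Real.sqrt_nonneg _) (norm_torus_le _))
  rw [hφ.testDeriv_proj, ← Real.norm_eq_abs]
  refine (ContinuousLinearMap.le_opNorm _ _).trans ?_
  gcongr
  · exact (hA (t, y) ⟨ht, by simpa using hy'⟩).trans (le_max_left _ _)
  · rw [Prod.norm_def]
    simp only [norm_one]
    exact max_le (by linarith [norm_nonneg v]) (by linarith)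

theorem IsSmoothTest.translate {φ : ℝ → Torus n → ℝ} (hφ : IsSmoothTest φ) (a : Torus n) :
    IsSmoothTest (fun t x => φ t (x + a)) := by
  obtain ⟨h, rfl⟩ := isOpenQuotientMap_proj.surjective a
  have : ContDiff ℝ ∞ ((fun p : ℝ × Vel n => φ p.1 (proj p.2)) ∘
    fun p : ℝ × Vel n => (p.1, p.2 + h)) := ContDiff.comp hφ (by fun_prop)
  simpa only [IsSmoothTest, Function.comp_def, proj_add] using this

theorem testDeriv_translate (φ : ℝ → Torus n → ℝ) (a : Torus n) (p : ℝ × Torus n × Vel n) :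
    testDeriv (fun t x => φ t (x + a)) p = testDeriv φ (p.1, p.2.1 + a, p.2.2) := by
  simp only [testDeriv, torusFDeriv_translate]

/-- Testing holonomy with φ = t fixes the total mass of a plan. -/
theorem isSmoothTest_time : IsSmoothTest (fun (t : ℝ) (_ : Torus n) => t) :=
  contDiff_fst

theorem testDeriv_time (p : ℝ × Torus n × Vel n) :
    testDeriv (fun (t : ℝ) (_ : Torus n) => t) p = 1 := by
  simp [testDeriv, torusFDeriv]

end Test

/-! ### Lipschitz and growth bounds for the Lagrangian -/

section Lagrangian

variable {n : ℕ} {L : Torus n → Vel n → ℝ}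

theorem IsLagrangian.exists_lipschitz (hL : IsLagrangian L) :
    ∃ C : ℝ, 0 ≤ C ∧ ∀ x a v, |L (x + a) v - L x v| ≤ C * ‖a‖ := by
  obtain ⟨C, hC⟩ := hL.bounded_deriv
  have hC0 : 0 ≤ C := (norm_nonneg _).trans (hC 0 0)
  refine ⟨C * √n, by positivity, fun x a v => ?_⟩
  obtain ⟨y, rfl⟩ := isOpenQuotientMap_proj.surjective x
  obtain ⟨h, rfl, hh⟩ := exists_proj_eq_norm_le a
  have hd : Differentiable ℝ (fun z : Vel n => L (proj z) v) := by
    have : ContDiff ℝ ∞ ((fun p : Vel n × Vel n => L (proj p.1) p.2) ∘ fun z : Vel n => (z, v)) :=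
      hL.smooth.comp (by fun_prop)
    exact this.differentiable (by simp)
  have := Convex.norm_image_sub_le_of_norm_fderiv_le (𝕜 := ℝ) (C := C) (s := Set.univ) (x := y)
    (y := y + h) (fun z _ => hd z)
    (fun z _ => by rw [← torusFDeriv_proj (fun x => L x v)]; exact hC _ _) convex_univ
    trivial trivial
  rw [proj_add, Real.norm_eq_abs, add_sub_cancel_left] at this
  calc _ ≤ C * ‖h‖ := this
    _ ≤ C * (√n * ‖proj h‖) := by gcongr
    _ = _ := by ring

theorem IsLagrangian.continuous (hL : IsLagrangian L) :
    Continuous (fun p : Torus n × Vel n => L p.1 p.2) := by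
  have hq : IsOpenQuotientMap (Prod.map proj id : Vel n × Vel n → Torus n × Vel n) :=
    isOpenQuotientMap_proj.prodMap IsOpenQuotientMap.id
  rw [← hq.continuous_comp_iff]
  exact hL.smooth.continuous

/-- Superlinearity is assumed separately at each x. It is used at x = 0 only, and the Lipschitz
bound, uniform in v, carries it to all x since the torus is bounded. -/
theorem IsLagrangian.exists_mul_norm_le (hL : IsLagrangian L) (A : ℝ) :
    ∃ c : ℝ, ∀ x v, A * ‖v‖ ≤ L x v + c := by
  obtain ⟨C, hC0, hC⟩ := hL.exists_lipschitz
  have h1 : ∀ᶠ v in Bornology.cobounded (Vel n), A ≤ L 0 v / ‖v‖ :=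
    (hL.superlinear 0).eventually_ge_atTop A
  have h2 : ∀ᶠ v in Bornology.cobounded (Vel n), 1 ≤ ‖v‖ :=
    tendsto_norm_cobounded_atTop.eventually_ge_atTop 1
  obtain ⟨R, -, hR⟩ := (Metric.hasBasis_cobounded_compl_closedBall (0 : Vel n)).eventually_iff.1
    (h1.and h2)
  have hcont : Continuous fun v : Vel n => A * ‖v‖ - L 0 v := by
    have := hL.continuous.comp (by fun_prop : Continuous fun v : Vel n => ((0 : Torus n), v))
    exact (continuous_const.mul continuous_norm).sub this
  obtain ⟨B, hB⟩ := (isCompact_closedBall (0 : Vel n) R).exists_bound_of_continuousOn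
    hcont.continuousOn
  refine ⟨max B 0 + C, fun x v => ?_⟩
  have hx : L 0 v - C ≤ L x v := by
    have := hC 0 x v
    rw [zero_add] at this
    have h3 := (abs_le.1 this).1
    have h4 : C * ‖x‖ ≤ C := mul_le_of_le_one_right hC0 (norm_torus_le x)
    linarith
  have h0 : A * ‖v‖ ≤ L 0 v + max B 0 := by
    by_cases hv : v ∈ Metric.closedBall (0 : Vel n) R
    · have := (le_abs_self _).trans (hB v hv)
      linarith [le_max_left B 0]
    · have := hR hv
      have h5 := (le_div_iff₀ (by linarith [this.2])).1 this.1
      linarith [le_max_right B 0]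
  linarith

theorem IsLagrangian.exists_linear_growth_le (hL : IsLagrangian L) (A : ℝ) {ε : ℝ} (hε : 0 < ε) :
    ∃ c : ℝ, ∀ x v, A * (1 + ‖v‖) ≤ ε * L x v + c := by
  obtain ⟨c, hc⟩ := hL.exists_mul_norm_le (A / ε)
  refine ⟨A + ε * c, fun x v => ?_⟩
  have := mul_le_mul_of_nonneg_left (hc x v) hε.le
  have h2 : ε * (A / ε * ‖v‖) = A * ‖v‖ := by field_simp
  linarith

end Lagrangian

/-! ### Lower semicontinuity and the direct method -/

section Minimization

variable {X : Type*} [TopologicalSpace X] [MeasurableSpace X] [BorelSpace X]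

/-- The bounded truncations min(f, N) pass to the weak limit; monotone convergence then removes N.
-/
theorem lintegral_le_of_tendsto_probabilityMeasure {ι : Type*} {l : Filter ι} [l.NeBot]
    {μs : ι → ProbabilityMeasure X} {μ : ProbabilityMeasure X} (hμ : Tendsto μs l (𝓝 μ))
    {f : X → NNReal} (hf : Continuous f) {b : ENNReal}
    (hb : ∀ᶠ i in l, ∫⁻ x, f x ∂(μs i : Measure X) ≤ b) :
    ∫⁻ x, f x ∂(μ : Measure X) ≤ b := by
  have h1 : ∀ N : ℕ, ∫⁻ x, ((min (f x) N : NNReal) : ENNReal) ∂(μ : Measure X) ≤ b := by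
    intro N
    let F : BoundedContinuousFunction X NNReal :=
      BoundedContinuousFunction.mkOfBound ⟨fun x => min (f x) N, by fun_prop⟩ N (by
        intro x y
        rw [NNReal.dist_eq]
        have hx : ((min (f x) N : NNReal) : ℝ) ≤ N := by exact_mod_cast min_le_right _ _
        have hy : ((min (f y) N : NNReal) : ℝ) ≤ N := by exact_mod_cast min_le_right _ _
        have hx0 : 0 ≤ ((min (f x) N : NNReal) : ℝ) := NNReal.coe_nonneg _
        have hy0 : 0 ≤ ((min (f y) N : NNReal) : ℝ) := NNReal.coe_nonneg _
        exact abs_sub_le_iff.2 ⟨by simp only [ContinuousMap.coe_mk]; linarith,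
          by simp only [ContinuousMap.coe_mk]; linarith⟩)
    have := ProbabilityMeasure.tendsto_iff_forall_lintegral_tendsto.1 hμ F
    refine le_of_tendsto this (hb.mono fun i hi => le_trans (lintegral_mono fun x => ?_) hi)
    exact ENNReal.coe_le_coe.2 (min_le_left _ _)
  have h2 : ∀ x, (f x : ENNReal) = ⨆ N : ℕ, ((min (f x) N : NNReal) : ENNReal) := by
    intro x
    refine le_antisymm ?_ (iSup_le fun N => ENNReal.coe_le_coe.2 (min_le_left _ _))
    obtain ⟨N, hN⟩ := exists_nat_ge (f x)
    exact le_iSup_of_le N (by rw [min_eq_left hN])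
  simp_rw [h2]
  rw [lintegral_iSup]
  · exact iSup_le h1
  · intro N
    exact (by fun_prop : Continuous fun x => ((min (f x) N : NNReal) : ENNReal)).measurable
  · intro N M h x
    exact ENNReal.coe_le_coe.2 (min_le_min_left _ (by exact_mod_cast h))

theorem integral_le_of_tendsto_probabilityMeasure {ι : Type*} {l : Filter ι} [l.NeBot]
    {μs : ι → ProbabilityMeasure X} {μ : ProbabilityMeasure X} (hμ : Tendsto μs l (𝓝 μ))
    {f : X → ℝ} (hf : Continuous f) {c : ℝ} (hc : ∀ x, c ≤ f x) {b : ℝ}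
    (hb : ∀ᶠ i in l, Integrable f (μs i : Measure X) ∧ ∫ x, f x ∂(μs i : Measure X) ≤ b) :
    Integrable f (μ : Measure X) ∧ ∫ x, f x ∂(μ : Measure X) ≤ b := by
  have hpos : ∀ x, 0 ≤ f x - c := fun x => sub_nonneg.2 (hc x)
  have hcont : Continuous fun x => Real.toNNReal (f x - c) := by fun_prop
  have key : ∫⁻ x, ENNReal.ofReal (f x - c) ∂(μ : Measure X) ≤ ENNReal.ofReal (b - c) := by
    refine lintegral_le_of_tendsto_probabilityMeasure hμ hcont (hb.mono fun i hi => ?_)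
    have h3 : Integrable (fun x => f x - c) (μs i : Measure X) := hi.1.sub (integrable_const c)
    have h4 := ofReal_integral_eq_lintegral_ofReal h3 (ae_of_all _ hpos)
    change ∫⁻ x, ENNReal.ofReal (f x - c) ∂(μs i : Measure X) ≤ _
    rw [← h4]
    refine ENNReal.ofReal_le_ofReal ?_
    rw [integral_sub hi.1 (integrable_const c)]
    simp [hi.2]
  have hint : Integrable (fun x => f x - c) (μ : Measure X) := by
    refine ⟨(by fun_prop : Continuous fun x => f x - c).aestronglyMeasurable, ?_⟩
    rw [hasFiniteIntegral_iff_ofReal (ae_of_all _ hpos)]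
    exact key.trans_lt ENNReal.ofReal_lt_top
  have hintf : Integrable f (μ : Measure X) := by
    refine (hint.add (integrable_const c)).congr (ae_of_all _ fun x => ?_)
    simp
  refine ⟨hintf, ?_⟩
  obtain ⟨i, hi⟩ := hb.exists
  -- `ENNReal.ofReal` truncates at 0, so the bound can be read back in ℝ only once b - c is
  -- nonnegative.
  have hbc : 0 ≤ b - c := by
    have : c ≤ ∫ x, f x ∂(μs i : Measure X) := by
      have := integral_mono (integrable_const c) hi.1 hc
      simpa using this
    linarith [hi.2]
  have h5 := ofReal_integral_eq_lintegral_ofReal hint (ae_of_all _ hpos)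
  rw [← h5, ENNReal.ofReal_le_ofReal_iff hbc, integral_sub hintf (integrable_const c)] at key
  simpa using key

/-- A coercive integral functional attains its minimum over the probability measures supported in a
closed set which satisfy integral constraints of smaller growth. -/
theorem exists_integral_minimizer [T2Space X] [HasOuterApproxClosed X] {ι : Type*}
    {Λ : X → ℝ} (hΛ : Continuous Λ) {D : Set X} (hD : IsClosed D)
    (hcomp : ∀ c, IsCompact ({x | Λ x ≤ c} ∩ D)) {b : ℝ} (hb : ∀ x, b ≤ Λ x)
    {F : ι → X → ℝ} (hF : ∀ i, Continuous (F i))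
    (hFΛ : ∀ i, ∀ ε > 0, ∃ c, ∀ x, |F i x| ≤ ε * Λ x + c) (r : ι → ℝ)
    {S : Set (ProbabilityMeasure X)}
    (hmem : ∀ μ, μ ∈ S ↔ (μ : Measure X) Dᶜ = 0 ∧ Integrable Λ (μ : Measure X) ∧
      ∀ i, ∫ x, F i x ∂(μ : Measure X) = r i) (hne : S.Nonempty) :
    ∃ μ ∈ S, ∀ ν ∈ S, ∫ x, Λ x ∂(μ : Measure X) ≤ ∫ x, Λ x ∂(ν : Measure X) := by
  have hblow : ∀ μ ∈ S, b ≤ ∫ x, Λ x ∂(μ : Measure X) := fun μ hμ => by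
    simpa using integral_mono (integrable_const b) ((hmem _).1 hμ).2.1 hb
  set V : Set ℝ := (fun μ : ProbabilityMeasure X => ∫ x, Λ x ∂(μ : Measure X)) '' S with hV
  have hVbdd : BddBelow V := ⟨b, by rintro _ ⟨μ, hμ, rfl⟩; exact hblow μ hμ⟩
  obtain ⟨u, hanti, hlim, hu⟩ := exists_seq_tendsto_sInf (hne.image _) hVbdd
  choose μs hμs hμu using hu
  have hbd : ∀ k, ∫ x, Λ x ∂(μs k : Measure X) ≤ u 0 := fun k =>
    (hμu k).trans_le (hanti (Nat.zero_le k))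
  have htight : IsTightMeasureSet {((μ : ProbabilityMeasure X) : Measure X) | μ ∈ Set.range μs} := by
    rw [isTightMeasureSet_iff_exists_isCompact_measure_compl_le]
    intro ε hε
    obtain ⟨δ, hδ, hδε⟩ : ∃ δ : ℝ, 0 < δ ∧ ENNReal.ofReal δ ≤ ε := by
      rcases eq_or_ne ε ⊤ with rfl | hε'
      · exact ⟨1, one_pos, le_top⟩
      · exact ⟨ε.toReal, ENNReal.toReal_pos hε.ne' hε', by rw [ENNReal.ofReal_toReal hε']⟩
    have hub : 0 ≤ u 0 - b := sub_nonneg.2 ((hblow _ (hμs 0)).trans (hbd 0))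
    -- Markov's inequality for Λ - b bounds the tail mass by (u 0 - b) / (c - b) ≤ δ; the summand 1
    -- keeps c > b.
    set c : ℝ := b + (u 0 - b + 1) / δ with hc
    refine ⟨_, hcomp c, ?_⟩
    rintro _ ⟨_, ⟨k, rfl⟩, rfl⟩
    obtain ⟨h1, h2, -⟩ := (hmem _).1 (hμs k)
    have hsub : ({x | Λ x ≤ c} ∩ D)ᶜ ⊆ {x | c - b ≤ Λ x - b} ∪ Dᶜ := by
      intro x hx
      by_cases hxD : x ∈ D
      · left
        have : ¬ Λ x ≤ c := fun h => hx ⟨h, hxD⟩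
        simp only [Set.mem_ofPred_eq]; linarith
      · exact Or.inr hxD
    have hmk := mul_meas_ge_le_integral_of_nonneg (μ := (μs k : Measure X)) (f := fun x => Λ x - b)
      (ae_of_all _ fun x => sub_nonneg.2 (hb x)) (h2.sub (integrable_const b)) (c - b)
    rw [integral_sub h2 (integrable_const b)] at hmk
    simp only [integral_const, probReal_univ, one_smul] at hmk
    have hcb : c - b = (u 0 - b + 1) / δ := by rw [hc]; ring
    have hcb0 : 0 < c - b := by rw [hcb]; positivity
    have hle : (μs k : Measure X).real {x | c - b ≤ Λ x - b} ≤ δ := by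
      have h6 : (c - b) * (μs k : Measure X).real {x | c - b ≤ Λ x - b} ≤ (c - b) * δ := by
        refine hmk.trans ?_
        rw [hcb, div_mul_cancel₀ _ hδ.ne']
        linarith [hbd k]
      exact le_of_mul_le_mul_left h6 hcb0
    calc (μs k : Measure X) ({x | Λ x ≤ c} ∩ D)ᶜ
        ≤ (μs k : Measure X) ({x | c - b ≤ Λ x - b} ∪ Dᶜ) := measure_mono hsub
      _ ≤ (μs k : Measure X) {x | c - b ≤ Λ x - b} + (μs k : Measure X) Dᶜ := measure_union_le _ _
      _ = (μs k : Measure X) {x | c - b ≤ Λ x - b} := by rw [h1, add_zero]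
      _ ≤ ENNReal.ofReal δ := by
          rw [← ENNReal.ofReal_toReal (measure_ne_top (μs k : Measure X) {x | c - b ≤ Λ x - b})]
          exact ENNReal.ofReal_le_ofReal hle
      _ ≤ ε := hδε
  obtain ⟨μ, -, hμ⟩ := (isCompact_closure_of_isTightMeasureSet htight).ultrafilter_le_nhds
    -- A limit along an ultrafilter replaces a convergent subsequence, so the space of measures need
    -- not be metrizable.
    ((hyperfilter ℕ : Ultrafilter ℕ).map μs)
    (le_principal_iff.2 (mem_of_superset (Filter.range_mem_map) subset_closure))
  have hconv : Tendsto μs (hyperfilter ℕ : Filter ℕ) (𝓝 μ) := hμ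
  have hhyp : (hyperfilter ℕ : Filter ℕ) ≤ atTop := Nat.hyperfilter_le_atTop
  have hΛlim : ∀ ε > 0, Integrable Λ (μ : Measure X) ∧
      ∫ x, Λ x ∂(μ : Measure X) ≤ sInf V + ε := by
    intro ε hε
    refine integral_le_of_tendsto_probabilityMeasure hconv hΛ hb ?_
    refine ((hlim.mono_left hhyp).eventually_le_const (lt_add_of_pos_right _ hε)).mono fun k hk => ?_
    exact ⟨((hmem _).1 (hμs k)).2.1, (hμu k).trans_le hk⟩
  have hΛint := (hΛlim 1 one_pos).1
  have hΛle : ∫ x, Λ x ∂(μ : Measure X) ≤ sInf V :=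
    le_of_forall_pos_le_add fun ε hε => (hΛlim ε hε).2
  have hsmall : ∀ i, ∀ ν : ProbabilityMeasure X, Integrable Λ (ν : Measure X) →
      Integrable (F i) (ν : Measure X) := by
    intro i ν hν
    obtain ⟨c, hc⟩ := hFΛ i 1 one_pos
    refine ((hν.const_mul 1).add (integrable_const c)).mono' (hF i).aestronglyMeasurable
      (ae_of_all _ fun x => ?_)
    exact hc x
  -- G need not be bounded below, but G + εΛ is, so it is lower semicontinuous; then ε → 0. Applying
  -- this to F and to -F preserves the equality constraints.
  have hone : ∀ G : X → ℝ, Continuous G → (∀ ε > 0, ∃ c, ∀ x, |G x| ≤ ε * Λ x + c) →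
      ∀ s : ℝ, (∀ k, Integrable G (μs k : Measure X) ∧ ∫ x, G x ∂(μs k : Measure X) = s) →
      Integrable G (μ : Measure X) → ∫ x, G x ∂(μ : Measure X) ≤ s := by
    intro G hG hGΛ s hs hGμ
    have hstep : ∀ ε > 0, ∫ x, G x ∂(μ : Measure X) ≤ s + ε * (u 0 - ∫ x, Λ x ∂(μ : Measure X)) := by
      intro ε hε
      obtain ⟨c, hc⟩ := hGΛ ε hε
      have := (integral_le_of_tendsto_probabilityMeasure hconv
        (f := fun x => G x + ε * Λ x) (by fun_prop) (c := -c)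
        (fun x => by linarith [(abs_le.1 (hc x)).1]) (b := s + ε * u 0)
        (Eventually.of_forall fun k => ?_)).2
      · rw [integral_add hGμ (hΛint.const_mul ε), integral_const_mul] at this
        linarith
      · have hk := ((hmem _).1 (hμs k)).2.1
        refine ⟨(hs k).1.add (hk.const_mul ε), ?_⟩
        rw [integral_add (hs k).1 (hk.const_mul ε), integral_const_mul, (hs k).2]
        gcongr
        exact hbd k
    have hlim0 : Tendsto (fun ε : ℝ => s + ε * (u 0 - ∫ x, Λ x ∂(μ : Measure X))) (𝓝[>] 0)
        (𝓝 (s + 0 * (u 0 - ∫ x, Λ x ∂(μ : Measure X)))) := by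
      refine Tendsto.mono_left ?_ nhdsWithin_le_nhds
      exact (by fun_prop : Continuous fun ε : ℝ =>
        s + ε * (u 0 - ∫ x, Λ x ∂(μ : Measure X))).tendsto 0
    rw [zero_mul, add_zero] at hlim0
    exact ge_of_tendsto hlim0 (eventually_mem_nhdsWithin.mono hstep)
  have hμS : μ ∈ S := by
    refine (hmem _).2 ⟨?_, hΛint, fun i => le_antisymm ?_ ?_⟩
    · have := ProbabilityMeasure.le_liminf_measure_open_of_tendsto hconv hD.isOpen_compl
      have h0 : (fun k => (μs k : Measure X) Dᶜ) = fun _ => 0 :=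
        funext fun k => ((hmem _).1 (hμs k)).1
      rw [h0, liminf_const] at this
      exact le_antisymm this zero_le
    · exact hone (F i) (hF i) (hFΛ i) (r i)
        (fun k => ⟨hsmall i _ ((hmem _).1 (hμs k)).2.1, ((hmem _).1 (hμs k)).2.2 i⟩) (hsmall i μ hΛint)
    · have := hone (fun x => -F i x) (hF i).neg (fun ε hε => by simpa using hFΛ i ε hε) (-r i)
        (fun k => ⟨(hsmall i _ ((hmem _).1 (hμs k)).2.1).neg, by
          rw [integral_neg, ((hmem _).1 (hμs k)).2.2 i]⟩) (hsmall i μ hΛint).neg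
      rw [integral_neg] at this
      linarith
  exact ⟨μ, hμS, fun ν hν => hΛle.trans (csInf_le hVbdd ⟨ν, hν, rfl⟩)⟩

end Minimization

/-! ### Superposition and translation of plans -/

section Plans

variable {n : ℕ} {T : ℝ}

theorem IsPlan.integrable_testDeriv {θ : Measure (Torus n)} {ρ : Measure (ℝ × Torus n × Vel n)}
    (hρ : IsPlan T θ ρ) {φ : ℝ → Torus n → ℝ} (hφ : IsSmoothTest φ) :
    Integrable (testDeriv φ) ρ := by
  have := hρ.finite
  obtain ⟨A, -, hA⟩ := hφ.exists_abs_testDeriv_le T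
  refine (((integrable_const (1 : ℝ)).add hρ.integrable_vel.norm).const_mul A).mono'
    hφ.continuous_testDeriv.aestronglyMeasurable ?_
  filter_upwards [hρ.time_mem] with p hp
  exact hA _ hp _ _

theorem IsPlan.real_univ {θ : Measure (Torus n)} {ρ : Measure (ℝ × Torus n × Vel n)}
    (hρ : IsPlan T θ ρ) : ρ.real Set.univ = θ.real Set.univ * T := by
  have h : ∫ p, testDeriv (fun (t : ℝ) (_ : Torus n) => t) p ∂ρ = ∫ _, (T - 0) ∂θ :=
    hρ.holonomy _ isSmoothTest_time
  simpa [testDeriv_time] using h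

theorem IsSmoothTest.integrable_boundary {φ : ℝ → Torus n → ℝ} (hφ : IsSmoothTest φ)
    (θ : Measure (Torus n)) [IsFiniteMeasure θ] : Integrable (fun x => φ T x - φ 0 x) θ := by
  have h : ∀ t, Continuous (φ t) := fun t => hφ.continuous.comp (by fun_prop : Continuous (t, ·))
  exact ((h T).sub (h 0)).integrable_of_hasCompactSupport (HasCompactSupport.of_compactSpace _)

theorem IsPlan.zero : IsPlan T (0 : Measure (Torus n)) 0 where
  finite := inferInstance
  time_mem := by simp
  integrable_vel := by simp
  holonomy := by simp

theorem IsPlan.add {θ₁ θ₂ : Measure (Torus n)} [IsFiniteMeasure θ₁] [IsFiniteMeasure θ₂]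
    {ρ₁ ρ₂ : Measure (ℝ × Torus n × Vel n)} (h₁ : IsPlan T θ₁ ρ₁) (h₂ : IsPlan T θ₂ ρ₂) :
    IsPlan T (θ₁ + θ₂) (ρ₁ + ρ₂) where
  finite := by
    have := h₁.finite
    have := h₂.finite
    infer_instance
  time_mem := ae_add_measure_iff.2 ⟨h₁.time_mem, h₂.time_mem⟩
  integrable_vel := h₁.integrable_vel.add_measure h₂.integrable_vel
  holonomy φ hφ := by
    rw [integral_add_measure (hφ.integrable_boundary θ₁) (hφ.integrable_boundary θ₂),
      ← h₁.holonomy φ hφ, ← h₂.holonomy φ hφ]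
    exact integral_add_measure (h₁.integrable_testDeriv hφ) (h₂.integrable_testDeriv hφ)

theorem IsPlan.smul {θ : Measure (Torus n)} {ρ : Measure (ℝ × Torus n × Vel n)}
    (h : IsPlan T θ ρ) (c : NNReal) : IsPlan T (c • θ) (c • ρ) where
  finite := by
    have := h.finite
    infer_instance
  time_mem := Measure.ae_smul_measure h.time_mem c
  integrable_vel := h.integrable_vel.smul_measure_nnreal
  holonomy φ hφ := by
    rw [integral_smul_nnreal_measure, integral_smul_nnreal_measure, h.holonomy φ hφ]

/-- Translation of the position of `p` by `h`. -/
def translatePos (q : Torus n × (ℝ × Torus n × Vel n)) : ℝ × Torus n × Vel n :=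
  (q.2.1, q.2.2.1 + q.1, q.2.2.2)

theorem continuous_translatePos : Continuous (translatePos (n := n)) := by
  unfold translatePos; fun_prop

/-- For fixed h, holonomy of ρ tested with φ(t, x + h) gives the boundary term at a + h; integrate
over h by Fubini. -/
theorem IsPlan.translate {a : Torus n} {ρ : Measure (ℝ × Torus n × Vel n)}
    (hρ : IsPlan T (Measure.dirac a) ρ) (ν : Measure (Torus n)) [IsFiniteMeasure ν] :
    IsPlan T (ν.map (a + ·)) ((ν.prod ρ).map translatePos) := by
  have := hρ.finite
  have hm : Measurable (translatePos (n := n)) := continuous_translatePos.measurable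
  have htime : ∀ᵐ q ∂(ν.prod ρ), q.2.1 ∈ Set.Icc 0 T :=
    Measure.quasiMeasurePreserving_snd.ae hρ.time_mem
  have hvel : Integrable (fun q : Torus n × (ℝ × Torus n × Vel n) => q.2.2.2) (ν.prod ρ) :=
    hρ.integrable_vel.comp_snd ν
  refine ⟨inferInstance, ?_, ?_, fun φ hφ => ?_⟩
  · exact (ae_map_iff hm.aemeasurable (measurableSet_Icc.preimage measurable_fst)).2 htime
  · exact (integrable_map_measure (by fun_prop) hm.aemeasurable).2 hvel
  · change ∫ p, testDeriv φ p ∂_ = _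
    obtain ⟨A, -, hA⟩ := hφ.exists_abs_testDeriv_le T
    have hint : Integrable (fun q => testDeriv φ (translatePos q)) (ν.prod ρ) := by
      refine (((integrable_const (1 : ℝ)).add hvel.norm).const_mul A).mono'
        (hφ.continuous_testDeriv.comp continuous_translatePos).aestronglyMeasurable ?_
      filter_upwards [htime] with q hq
      exact hA _ hq _ _
    rw [integral_map hm.aemeasurable hφ.continuous_testDeriv.aestronglyMeasurable,
      integral_prod _ hint, integral_map (by fun_prop)]
    · refine integral_congr_ae (ae_of_all _ fun h => ?_)
      have h1 : ∫ p, testDeriv (fun t x => φ t (x + h)) p ∂ρ =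
          ∫ x, (φ T (x + h) - φ 0 (x + h)) ∂(Measure.dirac a) :=
        hρ.holonomy _ (hφ.translate h)
      simp only [testDeriv_translate, integral_dirac] at h1
      exact h1
    · have h : ∀ t, Continuous (φ t) :=
        fun t => hφ.continuous.comp (by fun_prop : Continuous (t, ·))
      exact ((h T).sub (h 0)).aestronglyMeasurable

theorem integrable_translate_lagrangian {L : Torus n → Vel n → ℝ} (hL : IsLagrangian L) {C δ : ℝ}
    (hC0 : 0 ≤ C) (hC : ∀ x a v, |L (x + a) v - L x v| ≤ C * ‖a‖)
    {ρ : Measure (ℝ × Torus n × Vel n)} [IsFiniteMeasure ρ]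
    (hint : Integrable (fun p : ℝ × Torus n × Vel n => L p.2.1 p.2.2) ρ)
    {ν : Measure (Torus n)} [IsFiniteMeasure ν] (hν : ∀ᵐ h ∂ν, ‖h‖ ≤ δ) :
    Integrable (fun p : ℝ × Torus n × Vel n => L p.2.1 p.2.2)
      ((ν.prod ρ).map translatePos) ∧
    ∫ p, L p.2.1 p.2.2 ∂((ν.prod ρ).map translatePos) ≤
      ν.real Set.univ * (∫ p, L p.2.1 p.2.2 ∂ρ + C * δ * ρ.real Set.univ) := by
  have hm : Measurable (translatePos (n := n)) := continuous_translatePos.measurable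
  have hLc : Continuous (fun p : ℝ × Torus n × Vel n => L p.2.1 p.2.2) :=
    hL.continuous.comp (by fun_prop : Continuous fun p : ℝ × Torus n × Vel n => p.2)
  have hle : ∀ᵐ q ∂(ν.prod ρ), |L (translatePos q).2.1 (translatePos q).2.2
      - L q.2.2.1 q.2.2.2| ≤ C * δ := by
    filter_upwards [Measure.quasiMeasurePreserving_fst.ae hν] with q hq
    exact (hC _ _ _).trans (by gcongr)
  have h1 : Integrable (fun q : Torus n × (ℝ × Torus n × Vel n) => L q.2.2.1 q.2.2.2)
      (ν.prod ρ) := hint.comp_snd ν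
  have h2 : Integrable (fun q => L (translatePos q).2.1 (translatePos q).2.2)
      (ν.prod ρ) := by
    refine (h1.norm.add (integrable_const (C * δ))).mono'
      (hLc.comp continuous_translatePos).aestronglyMeasurable ?_
    filter_upwards [hle] with q hq
    have := abs_sub_abs_le_abs_sub
      (L (translatePos q).2.1 (translatePos q).2.2) (L q.2.2.1 q.2.2.2)
    simp only [Real.norm_eq_abs, Pi.add_apply]
    linarith
  refine ⟨(integrable_map_measure hLc.aestronglyMeasurable hm.aemeasurable).2 h2, ?_⟩
  rw [integral_map hm.aemeasurable hLc.aestronglyMeasurable]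
  calc ∫ q, L (translatePos q).2.1 (translatePos q).2.2 ∂(ν.prod ρ)
      ≤ ∫ q, (L q.2.2.1 q.2.2.2 + C * δ) ∂(ν.prod ρ) := by
        refine integral_mono_ae h2 (h1.add (integrable_const _)) ?_
        filter_upwards [hle] with q hq
        linarith [(abs_le.1 hq).2]
    _ = ∫ q, L q.2.2.1 q.2.2.2 ∂(ν.prod ρ) + ν.real Set.univ * ρ.real Set.univ * (C * δ) := by
        rw [integral_add h1 (integrable_const _), integral_const, ← Set.univ_prod_univ,
          measureReal_prod_prod, smul_eq_mul]
    _ = _ := by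
        have : ∫ q, L q.2.2.1 q.2.2.2 ∂(ν.prod ρ) = ν.real Set.univ * ∫ p, L p.2.1 p.2.2 ∂ρ := by
          rw [integral_prod _ h1]
          simp only [integral_const, smul_eq_mul]
        rw [this]
        ring

end Plans

/-! ### Competitors built from closed straight lines -/

section Loops

variable {n : ℕ} {T : ℝ}

/-- The curve `t ↦ (t, x + t v, v)`. -/
def lineCurve (x : Torus n) (v : Vel n) (t : ℝ) : ℝ × Torus n × Vel n := (t, x + proj (t • v), v)

theorem continuous_lineCurve (x : Torus n) (v : Vel n) : Continuous (lineCurve x v) := by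
  have := continuous_proj (n := n)
  unfold lineCurve
  fun_prop

theorem integral_lineCurve {E : Type*} [NormedAddCommGroup E] [NormedSpace ℝ E] (hT : 0 ≤ T)
    (x : Torus n) (v : Vel n) {f : ℝ × Torus n × Vel n → E} (hf : Continuous f) :
    Integrable f ((volume.restrict (Set.Icc 0 T)).map (lineCurve x v)) ∧
    ∫ p, f p ∂((volume.restrict (Set.Icc 0 T)).map (lineCurve x v)) =
      ∫ t in 0..T, f (lineCurve x v t) := by
  have hm := (continuous_lineCurve x v).aemeasurable (μ := volume.restrict (Set.Icc 0 T))
  have hfs : AEStronglyMeasurable f ((volume.restrict (Set.Icc 0 T)).map (lineCurve x v)) := by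
    exact hf.aestronglyMeasurable
  constructor
  · rw [integrable_map_measure hfs hm]
    exact (hf.comp (continuous_lineCurve x v)).continuousOn.integrableOn_Icc
  · rw [integral_map hm hfs, intervalIntegral.integral_of_le hT, integral_Icc_eq_integral_Ioc]

/-- Holonomy is the fundamental theorem of calculus along the curve, which closes up at x because T
v is an integer vector. -/
theorem isPlan_lineCurve (hT : 0 ≤ T) (x : Torus n) {v : Vel n} (hv : proj (T • v) = 0) :
    IsPlan T (Measure.dirac x) ((volume.restrict (Set.Icc 0 T)).map (lineCurve x v)) := by
  have hm := (continuous_lineCurve x v).aemeasurable (μ := volume.restrict (Set.Icc 0 T))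
  refine ⟨inferInstance, ?_, ?_, fun φ hφ => ?_⟩
  · rw [ae_map_iff hm (measurableSet_Icc.preimage measurable_fst)]
    exact ae_restrict_mem measurableSet_Icc
  · exact (integral_lineCurve hT x v (by fun_prop)).1
  · change ∫ p, testDeriv φ p ∂_ = _
    rw [(integral_lineCurve hT x v hφ.continuous_testDeriv).2, integral_dirac]
    obtain ⟨y, rfl⟩ := isOpenQuotientMap_proj.surjective x
    have hder : ∀ t ∈ Set.uIcc 0 T, HasDerivAt (fun t : ℝ => φ t (proj (y + t • v)))
        (testDeriv φ (lineCurve (proj y) v t)) t := by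
      intro t _
      have h1 : HasDerivAt (fun t : ℝ => (t, y + t • v)) ((1 : ℝ), v) t := by
        simpa using (hasDerivAt_id t).prodMk (((hasDerivAt_id t).smul_const v).const_add y)
      have h2 := (hφ.differentiable (t, y + t • v)).hasFDerivAt.comp_hasDerivAt t h1
      rw [lineCurve, ← proj_add, hφ.testDeriv_proj]
      exact h2
    rw [intervalIntegral.integral_eq_sub_of_hasDerivAt hder
      ((hφ.continuous_testDeriv.comp (continuous_lineCurve _ v)).intervalIntegrable _ _)]
    simp [proj_add, hv]

/-- Loops realize every integer rotation vector, and the realizable vectors form a convex set. Q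
lies in a unit cube with integer vertices. -/
theorem exists_plan_dirac {L : Torus n → Vel n → ℝ} (hL : IsLagrangian L) (hT : 0 < T)
    (x : Torus n) (Q : Vel n) : ∃ ρ : Measure (ℝ × Torus n × Vel n),
      IsPlan T (Measure.dirac x) ρ ∧ ∫ p, p.2.2 ∂ρ = Q ∧
      Integrable (fun p : ℝ × Torus n × Vel n => L p.2.1 p.2.2) ρ := by
  have hLc : Continuous (fun p : ℝ × Torus n × Vel n => L p.2.1 p.2.2) :=
    hL.continuous.comp (by fun_prop : Continuous fun p : ℝ × Torus n × Vel n => p.2)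
  let S : Set (Fin n → ℝ) := {q | ∃ ρ : Measure (ℝ × Torus n × Vel n),
      IsPlan T (Measure.dirac x) ρ ∧ ∫ p, p.2.2 ∂ρ = WithLp.toLp 2 q ∧
      Integrable (fun p : ℝ × Torus n × Vel n => L p.2.1 p.2.2) ρ}
  have hconv : Convex ℝ S := by
    rintro q₁ ⟨ρ₁, h₁, hq₁, hi₁⟩ q₂ ⟨ρ₂, h₂, hq₂, hi₂⟩ a b ha hb hab
    lift a to NNReal using ha
    lift b to NNReal using hb
    have hab' : a + b = 1 := by exact_mod_cast hab
    refine ⟨a • ρ₁ + b • ρ₂, ?_, ?_, ?_⟩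
    · have := (h₁.smul a).add (h₂.smul b)
      rwa [← add_smul, hab', one_smul] at this
    · rw [integral_add_measure h₁.integrable_vel.smul_measure_nnreal
        h₂.integrable_vel.smul_measure_nnreal, integral_smul_nnreal_measure,
        integral_smul_nnreal_measure, hq₁, hq₂]
      rfl
    · exact hi₁.smul_measure_nnreal.add_measure hi₂.smul_measure_nnreal
  have hint : ∀ k : Fin n → ℤ, (fun i => (k i : ℝ)) ∈ S := by
    intro k
    set v : Vel n := T⁻¹ • WithLp.toLp 2 (fun i => (k i : ℝ)) with hv
    have hTv : T • v = WithLp.toLp 2 (fun i => (k i : ℝ)) := by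
      rw [hv, smul_smul, mul_inv_cancel₀ hT.ne', one_smul]
    refine ⟨_, isPlan_lineCurve hT.le x (v := v) ?_, ?_, (integral_lineCurve hT.le x v hLc).1⟩
    · rw [hTv]
      ext i
      exact (AddCircle.coe_eq_zero_iff (1 : ℝ)).2 ⟨k i, by simp⟩
    · rw [(integral_lineCurve hT.le x v (by fun_prop)).2]
      simp only [lineCurve]
      rw [intervalIntegral.integral_const, sub_zero, hTv]
  have hQ : (fun i => Q i) ∈ convexHull ℝ
      (Set.univ.pi fun i => ({(⌊Q i⌋ : ℝ), (⌊Q i⌋ : ℝ) + 1} : Set ℝ)) := by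
    rw [convexHull_pi]
    intro i _
    beta_reduce
    rw [convexHull_pair, segment_eq_Icc (by linarith)]
    exact ⟨Int.floor_le _, (Int.lt_floor_add_one _).le⟩
  have hsub : (Set.univ.pi fun i => ({(⌊Q i⌋ : ℝ), (⌊Q i⌋ : ℝ) + 1} : Set ℝ)) ⊆ S := by
    intro q hq
    have : ∀ i, ∃ k : ℤ, (k : ℝ) = q i := by
      intro i
      rcases hq i trivial with h | h
      · exact ⟨⌊Q i⌋, h.symm⟩
      · exact ⟨⌊Q i⌋ + 1, by rw [h]; push_cast; rfl⟩
    choose k hk using this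
    rw [← funext hk]
    exact hint k
  exact convexHull_min hsub hconv hQ

end Loops

/-! ### Constrained plans, minimizers over point masses, and the minimax point -/

section Constrained

variable {n : ℕ} {T : ℝ} {W : Set (Vel n)} {Q : Vel n}

/-- Plans whose rotation vector is prescribed by `Q` in the directions of `W`. -/
def IsConstrainedPlan (T : ℝ) (W : Set (Vel n)) (Q : Vel n) (θ : Measure (Torus n))
    (ρ : Measure (ℝ × Torus n × Vel n)) : Prop :=
  IsPlan T θ ρ ∧ ∀ w ∈ W, ∫ p, inner ℝ w p.2.2 ∂ρ = θ.real Set.univ * inner ℝ w Q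

theorem IsPlan.isConstrainedPlan_empty {θ : Measure (Torus n)}
    {ρ : Measure (ℝ × Torus n × Vel n)} (h : IsPlan T θ ρ) : IsConstrainedPlan T ∅ Q θ ρ :=
  ⟨h, fun _ hw => hw.elim⟩

theorem isConstrainedPlan_univ_iff {θ : Measure (Torus n)} [IsProbabilityMeasure θ]
    {ρ : Measure (ℝ × Torus n × Vel n)} :
    IsConstrainedPlan T Set.univ Q θ ρ ↔ IsPlan T θ ρ ∧ ∫ p, p.2.2 ∂ρ = Q := by
  refine and_congr_right fun h => ?_
  simp only [Set.mem_univ, true_imp_iff, probReal_univ, one_mul,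
    integral_inner h.integrable_vel]
  exact ⟨fun h => ext_inner_left ℝ h, fun h w => by rw [h]⟩

theorem IsConstrainedPlan.zero : IsConstrainedPlan T W Q 0 0 :=
  ⟨IsPlan.zero, by simp⟩

theorem IsConstrainedPlan.add {θ₁ θ₂ : Measure (Torus n)} [IsFiniteMeasure θ₁]
    [IsFiniteMeasure θ₂] {ρ₁ ρ₂ : Measure (ℝ × Torus n × Vel n)}
    (h₁ : IsConstrainedPlan T W Q θ₁ ρ₁) (h₂ : IsConstrainedPlan T W Q θ₂ ρ₂) :
    IsConstrainedPlan T W Q (θ₁ + θ₂) (ρ₁ + ρ₂) := by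
  refine ⟨h₁.1.add h₂.1, fun w hw => ?_⟩
  rw [integral_add_measure (h₁.1.integrable_vel.const_inner w)
    (h₂.1.integrable_vel.const_inner w), h₁.2 w hw, h₂.2 w hw, measureReal_add_apply]
  ring

theorem IsConstrainedPlan.translate {a : Torus n} {ρ : Measure (ℝ × Torus n × Vel n)}
    (hρ : IsConstrainedPlan T W Q (Measure.dirac a) ρ) (ν : Measure (Torus n))
    [IsFiniteMeasure ν] :
    IsConstrainedPlan T W Q (ν.map (a + ·)) ((ν.prod ρ).map translatePos) := by
  have := hρ.1.finite
  refine ⟨hρ.1.translate ν, fun w hw => ?_⟩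
  have h1 := hρ.2 w hw
  rw [probReal_univ, one_mul] at h1
  rw [integral_map continuous_translatePos.aemeasurable
    (by fun_prop : Continuous fun p : ℝ × Torus n × Vel n => inner ℝ w p.2.2).aestronglyMeasurable]
  have h2 : Integrable (fun q : Torus n × (ℝ × Torus n × Vel n) =>
      inner ℝ w (translatePos q).2.2) (ν.prod ρ) :=
    Integrable.comp_snd (f := fun p : ℝ × Torus n × Vel n => inner ℝ w p.2.2)
      (hρ.1.integrable_vel.const_inner w) ν
  rw [integral_prod _ h2]
  have h3 : ∀ h : Torus n, ∫ p, inner ℝ w (translatePos (h, p)).2.2 ∂ρ = inner ℝ w Q :=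
    fun _ => h1
  simp only [h3, integral_const, smul_eq_mul]
  rw [map_measureReal_apply (by fun_prop) MeasurableSet.univ, Set.preimage_univ]

/-- Plans over a point mass have mass T, so division by T turns the problem into one over
probability measures, to which the direct method applies. -/
theorem exists_minimizer_dirac {L : Torus n → Vel n → ℝ} (hL : IsLagrangian L) (hT : 0 < T)
    (W : Set (Vel n)) (Q : Vel n) (x : Torus n) : ∃ ρ,
      IsConstrainedPlan T W Q (Measure.dirac x) ρ ∧
      Integrable (fun p : ℝ × Torus n × Vel n => L p.2.1 p.2.2) ρ ∧
      ∀ ρ', IsConstrainedPlan T W Q (Measure.dirac x) ρ' →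
        Integrable (fun p : ℝ × Torus n × Vel n => L p.2.1 p.2.2) ρ' →
        ∫ p, L p.2.1 p.2.2 ∂ρ ≤ ∫ p, L p.2.1 p.2.2 ∂ρ' := by
  have hLc : Continuous (fun p : ℝ × Torus n × Vel n => L p.2.1 p.2.2) :=
    hL.continuous.comp (by fun_prop : Continuous fun p : ℝ × Torus n × Vel n => p.2)
  -- The growth bound on `testDeriv` holds only for times in [0, T], while the direct method asks
  -- for it everywhere. Clamping the time supplies it and changes nothing almost everywhere for
  -- measures carried by D.
  let cut : ℝ × Torus n × Vel n → ℝ × Torus n × Vel n :=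
    fun p => (Set.projIcc 0 T hT.le p.1, p.2)
  have hcut : Continuous cut := by fun_prop
  let F : {φ : ℝ → Torus n → ℝ // IsSmoothTest φ} ⊕ W → ℝ × Torus n × Vel n → ℝ :=
    Sum.elim (fun φ p => testDeriv φ.1 (cut p)) (fun w p => inner ℝ w.1 p.2.2)
  let r : {φ : ℝ → Torus n → ℝ // IsSmoothTest φ} ⊕ W → ℝ :=
    Sum.elim (fun φ => T⁻¹ * (φ.1 T x - φ.1 0 x)) (fun w => T⁻¹ * inner ℝ w.1 Q)
  let D : Set (ℝ × Torus n × Vel n) := Prod.fst ⁻¹' Set.Icc 0 T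
  have hD : IsClosed D := isClosed_Icc.preimage continuous_fst
  let S : Set (ProbabilityMeasure (ℝ × Torus n × Vel n)) :=
    {μ | (μ : Measure (ℝ × Torus n × Vel n)) Dᶜ = 0 ∧
      Integrable (fun p : ℝ × Torus n × Vel n => L p.2.1 p.2.2)
        (μ : Measure (ℝ × Torus n × Vel n)) ∧
      ∀ i, ∫ p, F i p ∂(μ : Measure (ℝ × Torus n × Vel n)) = r i}
  obtain ⟨c₀, hc₀⟩ := hL.exists_mul_norm_le 1
  have hcutae : ∀ μ : Measure (ℝ × Torus n × Vel n), μ Dᶜ = 0 → ∀ᵐ p ∂μ, cut p = p := by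
    intro μ hμ
    have : ∀ᵐ p ∂μ, p ∈ D := hμ
    filter_upwards [this] with p hp
    have hp' : p.1 ∈ Set.Icc 0 T := hp
    simp only [cut, Set.projIcc_of_mem hT.le hp']
  let τ : NNReal := ⟨T, hT.le⟩
  have hof : ∀ ρ, IsConstrainedPlan T W Q (Measure.dirac x) ρ →
      Integrable (fun p : ℝ × Torus n × Vel n => L p.2.1 p.2.2) ρ →
      ∃ μ ∈ S, (μ : Measure (ℝ × Torus n × Vel n)) = τ⁻¹ • ρ := by
    intro ρ hρ hρL
    have := hρ.1.finite
    have hDρ : ρ Dᶜ = 0 := hρ.1.time_mem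
    have hprob : IsProbabilityMeasure (τ⁻¹ • ρ) := by
      rw [isProbabilityMeasure_iff_real, measureReal_nnreal_smul_apply, hρ.1.real_univ,
        probReal_univ, one_mul]
      exact inv_mul_cancel₀ hT.ne'
    refine ⟨⟨τ⁻¹ • ρ, hprob⟩, ⟨?_, hρL.smul_measure_nnreal, ?_⟩, rfl⟩
    · change (τ⁻¹ • ρ) Dᶜ = 0
      rw [Measure.smul_apply, hDρ, smul_zero]
    · rintro (φ | w)
      · change ∫ p, testDeriv φ.1 (cut p) ∂(τ⁻¹ • ρ) = T⁻¹ * (φ.1 T x - φ.1 0 x)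
        rw [integral_smul_nnreal_measure]
        have h1 : ∫ p, testDeriv φ.1 (cut p) ∂ρ = ∫ p, testDeriv φ.1 p ∂ρ :=
          integral_congr_ae ((hcutae ρ hDρ).mono fun p hp => by simp only [hp])
        have h2 : ∫ p, testDeriv φ.1 p ∂ρ = _ := hρ.1.holonomy φ.1 φ.2
        rw [h1, h2, integral_dirac]
        rfl
      · change ∫ p, inner ℝ w.1 p.2.2 ∂(τ⁻¹ • ρ) = T⁻¹ * inner ℝ w.1 Q
        rw [integral_smul_nnreal_measure, hρ.2 _ w.2, probReal_univ, one_mul]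
        rfl
  have hto : ∀ μ ∈ S, IsConstrainedPlan T W Q (Measure.dirac x)
      (τ • (μ : Measure (ℝ × Torus n × Vel n))) := by
    rintro μ ⟨h1, h2, h3⟩
    have hv : Integrable (fun p : ℝ × Torus n × Vel n => p.2.2)
        (μ : Measure (ℝ × Torus n × Vel n)) := by
      refine (h2.add (integrable_const c₀)).mono'
        (by fun_prop : Continuous fun p : ℝ × Torus n × Vel n => p.2.2).aestronglyMeasurable
        (ae_of_all _ fun p => ?_)
      have := hc₀ p.2.1 p.2.2
      rwa [one_mul] at this
    refine ⟨⟨inferInstance, ?_, hv.smul_measure_nnreal, fun φ hφ => ?_⟩, fun w hw => ?_⟩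
    · have h4 : ∀ᵐ p ∂(μ : Measure (ℝ × Torus n × Vel n)), p.1 ∈ Set.Icc 0 T := h1
      exact Measure.ae_smul_measure h4 τ
    · change ∫ p, testDeriv φ p ∂_ = _
      have h4 : ∫ p, testDeriv φ (cut p) ∂(μ : Measure (ℝ × Torus n × Vel n)) = T⁻¹ * _ :=
        h3 (Sum.inl ⟨φ, hφ⟩)
      have h5 : ∫ p, testDeriv φ (cut p) ∂(μ : Measure (ℝ × Torus n × Vel n)) =
          ∫ p, testDeriv φ p ∂(μ : Measure (ℝ × Torus n × Vel n)) :=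
        integral_congr_ae ((hcutae _ h1).mono fun p hp => by simp only [hp])
      rw [integral_smul_nnreal_measure, ← h5, h4, integral_dirac]
      exact mul_inv_cancel_left₀ hT.ne' _
    · have h4 : ∫ p, inner ℝ w p.2.2 ∂(μ : Measure (ℝ × Torus n × Vel n)) = T⁻¹ * inner ℝ w Q :=
        h3 (Sum.inr ⟨w, hw⟩)
      rw [integral_smul_nnreal_measure, h4, probReal_univ, one_mul]
      exact mul_inv_cancel_left₀ hT.ne' _
  obtain ⟨ρ₀, hρ₀, hQ₀, hρ₀L⟩ := exists_plan_dirac hL hT x Q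
  have hρ₀' : IsConstrainedPlan T W Q (Measure.dirac x) ρ₀ :=
    ⟨hρ₀, fun w _ => (isConstrainedPlan_univ_iff.2 ⟨hρ₀, hQ₀⟩).2 w trivial⟩
  have hne : S.Nonempty := by
    obtain ⟨μ, hμ, -⟩ := hof ρ₀ hρ₀' hρ₀L
    exact ⟨μ, hμ⟩
  have hex : ∃ μ ∈ S, ∀ ν ∈ S,
      ∫ p, L p.2.1 p.2.2 ∂(μ : Measure (ℝ × Torus n × Vel n)) ≤
        ∫ p, L p.2.1 p.2.2 ∂(ν : Measure (ℝ × Torus n × Vel n)) := by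
    refine exists_integral_minimizer hLc hD ?_ (b := -c₀) ?_ (F := F) ?_ ?_ r
      (fun μ => Iff.rfl) hne
    · intro c
      refine IsCompact.of_isClosed_subset ((isCompact_Icc (a := 0) (b := T)).prod (isCompact_univ.prod
        (isCompact_closedBall (0 : Vel n) (c + c₀))))
        ((isClosed_le hLc continuous_const).inter hD) ?_
      rintro p ⟨hp1, hp2⟩
      refine ⟨hp2, trivial, ?_⟩
      have h1 := hc₀ p.2.1 p.2.2
      have h2 : L p.2.1 p.2.2 ≤ c := hp1
      rw [mem_closedBall_zero_iff]
      linarith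
    · intro p
      have := hc₀ p.2.1 p.2.2
      linarith [norm_nonneg p.2.2]
    · rintro (φ | w)
      · exact φ.2.continuous_testDeriv.comp hcut
      · exact (by fun_prop : Continuous fun p : ℝ × Torus n × Vel n => inner ℝ w.1 p.2.2)
    · rintro (φ | w) ε hε
      · obtain ⟨A, -, hA⟩ := φ.2.exists_abs_testDeriv_le T
        obtain ⟨c, hc⟩ := hL.exists_linear_growth_le A hε
        exact ⟨c, fun p => (hA _ (Set.projIcc 0 T hT.le p.1).2 _ _).trans (hc _ _)⟩
      · obtain ⟨c, hc⟩ := hL.exists_linear_growth_le ‖w.1‖ hε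
        refine ⟨c, fun p => (abs_real_inner_le_norm _ _).trans (le_trans ?_ (hc p.2.1 p.2.2))⟩
        gcongr
        linarith
  obtain ⟨μ, hμ, hmin⟩ := hex
  refine ⟨_, hto μ hμ, hμ.2.1.smul_measure_nnreal, fun ρ' hρ' hρ'L => ?_⟩
  obtain ⟨μ', hμ', he⟩ := hof ρ' hρ' hρ'L
  have h1 := hmin μ' hμ'
  rw [he, integral_smul_nnreal_measure] at h1
  rw [integral_smul_nnreal_measure]
  calc T * ∫ p, L p.2.1 p.2.2 ∂(μ : Measure (ℝ × Torus n × Vel n))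
      ≤ T * (T⁻¹ * ∫ p, L p.2.1 p.2.2 ∂ρ') := mul_le_mul_of_nonneg_left h1 hT.le
    _ = _ := mul_inv_cancel_left₀ hT.ne' _

/-- Plans with the same rotation constraint over an arbitrary measure on the torus cost, up to `ε`,
at most as much as the most expensive optimal plan over a point mass. -/
theorem exists_plan_of_dirac_le {L : Torus n → Vel n → ℝ} (hL : IsLagrangian L) (hT : 0 < T) {M : ℝ}
    (hM : ∀ x : Torus n, ∃ ρ, IsConstrainedPlan T W Q (Measure.dirac x) ρ ∧
      Integrable (fun p : ℝ × Torus n × Vel n => L p.2.1 p.2.2) ρ ∧ ∫ p, L p.2.1 p.2.2 ∂ρ ≤ M)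
    (θ : Measure (Torus n)) [IsFiniteMeasure θ] {ε : ℝ} (hε : 0 < ε) :
    ∃ ρ, IsConstrainedPlan T W Q θ ρ ∧
      Integrable (fun p : ℝ × Torus n × Vel n => L p.2.1 p.2.2) ρ ∧
      ∫ p, L p.2.1 p.2.2 ∂ρ ≤ θ.real Set.univ * (M + ε) := by
  obtain ⟨C, hC0, hC⟩ := hL.exists_lipschitz
  -- Shifting a plan of mass T by at most δ costs at most C δ T ≤ ε; the 1 covers C = 0.
  set δ : ℝ := ε / (C * T + 1) with hδ
  have hCT : 0 ≤ C * T := by positivity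
  have hδ0 : 0 < δ := by positivity
  have hCδ : C * δ * T ≤ ε := by
    have h1 : C * δ * T = ε * ((C * T) / (C * T + 1)) := by rw [hδ]; ring
    rw [h1]
    exact mul_le_of_le_one_right hε.le ((div_le_one (by positivity)).2 (by linarith))
  -- Induction on the centres: peel B ∩ ball c δ off B, serve it by translates of the plan over δ_c,
  -- and leave the rest to the remaining balls.
  have key : ∀ t : Set (Torus n), t.Finite → ∀ B : Set (Torus n), MeasurableSet B →
      B ⊆ ⋃ c ∈ t, Metric.ball c δ →
      ∃ ρ, IsConstrainedPlan T W Q (θ.restrict B) ρ ∧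
        Integrable (fun p : ℝ × Torus n × Vel n => L p.2.1 p.2.2) ρ ∧
        ∫ p, L p.2.1 p.2.2 ∂ρ ≤ (θ.restrict B).real Set.univ * (M + ε) := by
    intro t ht
    induction t, ht using Set.Finite.induction_on with
    | empty =>
      intro B _ hB
      have : B = ∅ := by simpa using hB
      subst this
      exact ⟨0, by simpa using IsConstrainedPlan.zero, integrable_zero_measure, by simp⟩
    | @insert c t _ _ ih =>
      intro B hBm hB
      obtain ⟨ρ₁, h₁, hi₁, hl₁⟩ := ih (B \ Metric.ball c δ) (hBm.diff measurableSet_ball) (by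
        rw [Set.biUnion_insert] at hB
        exact Set.sdiff_subset_iff.2 hB)
      obtain ⟨ρ, hρ, hρi, hρl⟩ := hM c
      set θ' := θ.restrict (B ∩ Metric.ball c δ) with hθ'
      -- The displacements from c that rebuild the piece θ' when added back to c.
      set ν : Measure (Torus n) := θ'.map (· - c) with hν
      have hνball : ∀ᵐ h ∂ν, ‖h‖ ≤ δ := by
        rw [hν, ae_map_iff (by fun_prop) (measurableSet_le measurable_norm measurable_const), hθ']
        filter_upwards [ae_restrict_mem (hBm.inter measurableSet_ball)] with y hy
        rw [← dist_eq_norm]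
        exact (Metric.mem_ball.1 hy.2).le
      have hνmap : ν.map (c + ·) = θ' := by
        rw [hν, Measure.map_map (by fun_prop) (by fun_prop)]
        have : ((fun x => c + x) ∘ fun x => x - c) = id := by ext1 y; simp
        rw [this, Measure.map_id]
      have hνu : ν.real Set.univ = θ'.real Set.univ := by
        rw [hν, map_measureReal_apply (by fun_prop) MeasurableSet.univ, Set.preimage_univ]
      have := hρ.1.finite
      have h₂ := hρ.translate ν
      rw [hνmap] at h₂
      obtain ⟨hi₂, hl₂⟩ := integrable_translate_lagrangian hL hC0 hC hρi hνball
      rw [hρ.1.real_univ, probReal_univ (μ := Measure.dirac c), one_mul, hνu] at hl₂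
      have hsplit : θ' + θ.restrict (B \ Metric.ball c δ) = θ.restrict B :=
        Measure.restrict_inter_add_sdiff B measurableSet_ball
      refine ⟨_, hsplit ▸ h₂.add h₁, hi₂.add_measure hi₁, ?_⟩
      rw [integral_add_measure hi₂ hi₁, ← hsplit, measureReal_add_apply, add_mul]
      refine add_le_add (hl₂.trans ?_) hl₁
      gcongr
  obtain ⟨t, -, ht, hcov⟩ := (isCompact_univ (X := Torus n)).finite_cover_balls hδ0
  simpa using key t ht Set.univ MeasurableSet.univ hcov

/-- The point is a maximum of the minimal action over point masses, a Lipschitz function on a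
compact space. -/
theorem exists_minimax_point {L : Torus n → Vel n → ℝ} (hL : IsLagrangian L) (hT : 0 < T)
    (W : Set (Vel n)) (Q : Vel n) : ∃ x ρ, IsConstrainedPlan T W Q (Measure.dirac x) ρ ∧
      Integrable (fun p : ℝ × Torus n × Vel n => L p.2.1 p.2.2) ρ ∧
      (∀ ρ', IsConstrainedPlan T W Q (Measure.dirac x) ρ' →
        Integrable (fun p : ℝ × Torus n × Vel n => L p.2.1 p.2.2) ρ' →
        ∫ p, L p.2.1 p.2.2 ∂ρ ≤ ∫ p, L p.2.1 p.2.2 ∂ρ') ∧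
      ∀ θ : Measure (Torus n), IsProbabilityMeasure θ → ∀ ε > 0, ∃ ρ',
        IsConstrainedPlan T W Q θ ρ' ∧
        Integrable (fun p : ℝ × Torus n × Vel n => L p.2.1 p.2.2) ρ' ∧
        ∫ p, L p.2.1 p.2.2 ∂ρ' ≤ ∫ p, L p.2.1 p.2.2 ∂ρ + ε := by
  obtain ⟨C, hC0, hC⟩ := hL.exists_lipschitz
  choose ρ hρ hint hmin using exists_minimizer_dirac hL hT W Q
  let G : Torus n → ℝ := fun x => ∫ p, L p.2.1 p.2.2 ∂(ρ x)
  have hG : ∀ x y, G x ≤ G y + C * T * dist x y := by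
    intro x y
    have := (hρ y).1.finite
    -- A rigid shift by x - y makes the minimizer at y a competitor at x.
    have h₁ := (hρ y).translate (Measure.dirac (x - y))
    rw [Measure.map_dirac' (by fun_prop), add_sub_cancel] at h₁
    obtain ⟨h₂, h₃⟩ := integrable_translate_lagrangian hL hC0 hC (hint y)
      (ν := Measure.dirac (x - y)) (δ := dist x y)
      ((ae_dirac_iff (measurableSet_le measurable_norm measurable_const)).2
        (dist_eq_norm x y).ge)
    rw [probReal_univ, one_mul, (hρ y).1.real_univ, probReal_univ, one_mul] at h₃
    refine (hmin x _ h₁ h₂).trans (h₃.trans (le_of_eq ?_))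
    simp only [G]; ring
  have hGc : Continuous G :=
    (LipschitzWith.of_le_add_mul (⟨C * T, by positivity⟩ : NNReal) hG).continuous
  obtain ⟨x, -, hx⟩ := isCompact_univ.exists_isMaxOn Set.univ_nonempty hGc.continuousOn
  refine ⟨x, ρ x, hρ x, hint x, hmin x, fun θ hθ ε hε => ?_⟩
  obtain ⟨ρ', h1, h2, h3⟩ := exists_plan_of_dirac_le hL hT (W := W) (Q := Q) (M := G x)
    (fun y => ⟨ρ y, hρ y, hint y, hx (Set.mem_univ y)⟩) θ hε
  exact ⟨ρ', h1, h2, by simpa using h3⟩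

/-- Transfer to extended reals: plans with non-integrable L have action ⊤ and cannot compete. -/
theorem exists_isMinimax_dirac {L : Torus n → Vel n → ℝ} (hL : IsLagrangian L) (hT : 0 < T)
    (W : Set (Vel n)) (Q : Vel n) {S : Measure (Torus n) → Set (Measure (ℝ × Torus n × Vel n))}
    (hS : ∀ θ, IsProbabilityMeasure θ → ∀ ρ, ρ ∈ S θ ↔ IsConstrainedPlan T W Q θ ρ) :
    ∃ x : Torus n, IsMinimax (fun θ => minAction L (S θ)) (Measure.dirac x) ∧
      ∃ ρ, IsMinimizer L (S (Measure.dirac x)) ρ := by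
  obtain ⟨x, ρ, hρ, hint, hmin, hθ⟩ := exists_minimax_point hL hT W Q
  have hact : action L ρ = ((∫ p, L p.2.1 p.2.2 ∂ρ : ℝ) : EReal) := if_pos hint
  have hρS : ρ ∈ S (Measure.dirac x) := (hS _ inferInstance ρ).2 hρ
  have hval : minAction L (S (Measure.dirac x)) = action L ρ := by
    refine le_antisymm (iInf₂_le ρ hρS) (le_iInf₂ fun ρ' hρ' => ?_)
    by_cases hi : Integrable (fun p : ℝ × Torus n × Vel n => L p.2.1 p.2.2) ρ'
    · rw [hact, action, if_pos hi]
      exact EReal.coe_le_coe_iff.2 (hmin ρ' ((hS _ inferInstance ρ').1 hρ') hi)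
    · rw [action, action, if_neg hi]
      exact le_top
  refine ⟨x, ⟨inferInstance, fun θ hθp => ?_⟩, ρ, hρS, hval.symm, ?_⟩
  · change minAction L (S θ) ≤ minAction L (S (Measure.dirac x))
    rw [hval, hact]
    refine EReal.le_of_forall_lt_iff_le.1 fun z hz => ?_
    have hz' : 0 < z - ∫ p, L p.2.1 p.2.2 ∂ρ := sub_pos.2 (EReal.coe_lt_coe_iff.1 hz)
    obtain ⟨ρ', h1, h2, h3⟩ := hθ θ hθp _ hz'
    refine (iInf₂_le ρ' ((hS θ hθp ρ').2 h1)).trans ?_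
    rw [action, if_pos h2]
    exact EReal.coe_le_coe_iff.2 (by linarith)
  · rw [hact]
    exact EReal.coe_ne_top _

end Constrained

end MinimaxMather

end

theorem theorem8p4 (n : ℕ) (L : MinimaxMather.Torus n → MinimaxMather.Vel n → ℝ)
    (hL : MinimaxMather.IsLagrangian L) (T : ℝ) (hT : 0 < T) :
    (∀ Q : MinimaxMather.Vel n, ∃ x : MinimaxMather.Torus n,
      MinimaxMather.IsMinimax (MinimaxMather.gRot L T Q) (MeasureTheory.Measure.dirac x) ∧
      ∃ ρ, MinimaxMather.IsMinimizer L
        (MinimaxMather.plansRot T Q (MeasureTheory.Measure.dirac x)) ρ) ∧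
    (∃ x : MinimaxMather.Torus n,
      MinimaxMather.IsMinimax (MinimaxMather.g L T) (MeasureTheory.Measure.dirac x) ∧
      ∃ ρ, MinimaxMather.IsMinimizer L
        (MinimaxMather.plans T (MeasureTheory.Measure.dirac x)) ρ) := by
  refine ⟨fun Q => ?_, ?_⟩
  · exact MinimaxMather.exists_isMinimax_dirac hL hT Set.univ Q
      fun θ _ ρ => MinimaxMather.isConstrainedPlan_univ_iff.symm
  -- With no tested directions the rotation vector is free, and 0 is a dummy value.
  · exact MinimaxMather.exists_isMinimax_dirac hL hT ∅ 0
      fun θ _ ρ => ⟨fun h => h.isConstrainedPlan_empty, fun h => h.1⟩
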